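/- Let $\kappa>0$, $\varepsilon\in(0,\pi/2)$ and $R=(\pi-2\varepsilon)\tan\varepsilon$. Let $(X,d)$ be a complete $\mathrm{CAT}(\kappa)$ space with $\operatorname{diam}(X)\le\frac{\pi-\varepsilon}{2\sqrt\kappa}$, let $K$ be a nonempty closed convex subset of $X$, and let $T$ assign to every $x\in K$ a nonempty compact subset $Tx$ of $K$. Write $d(x,B)=\inf_{y\in B}d(x,y)$, and let $H$ be the Hausdorff distance. Suppose that $T$ is a generalized multivalued hybrid mapping of type II, that is, there are functions $a_1,a_2,a_3,k_1,k_2:K\to[0,1]$ with $a_1(x)+a_2(x)+a_3(x)<1$, $2k_1(x)<1-a_2(x)$ and $2k_2(x)<1-a_3(x)$ for all $x\in K$, such that for all $x,y\in K$ $$H(Tx,Ty)^2\le a_1(x)\,d(x,y)^2+a_2(x)\,d(y,Tx)^2+a_3(x)\,d(x,Ty)^2+k_1(x)\,d(x,Tx)^2+k_2(x)\,d(y,Ty)^2 .$$ Suppose further that either (i) $a_2(x)=0$ and $\frac{2k_2(x)}{1-a_3(x)}<\frac R2$ for all $x\in K$, or (ii) $a_3(x)=0$ and $\frac{2k_1(x)}{1-a_2(x)}<\frac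 R2$ for all $x\in K$. If $\sup_{x\in K}\frac{a_1(x)+k_1(x)}{1-k_2(x)}<1$, then $T$ has a fixed point, i.e. a point $z\in K$ with $z\in Tz$. Moreover, from every $x_0\in K$ there starts a sequence $(x_n)$ in $K$ with $x_{n+1}\in Tx_n$ and $d(x_{n+1},x_n)=d(x_n,Tx_n)$ for all $n\ge0$, and every such sequence is a Cauchy sequence and converges to a fixed point of $T$. -/

import Mathlib

open Set Filter Topology

namespace CATHybrid

/-- `c`, restricted to `[0, d(x, y)]`, is a geodesic path joining `x` to `y`. (The length of the
parameter interval of a geodesic path is necessarily the distance of its end points.) -/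
def IsGeodesic {Y : Type*} [Dist Y] (c : ℝ → Y) (x y : Y) : Prop :=
  c 0 = x ∧ c (dist x y) = y ∧
    ∀ r ∈ Icc (0 : ℝ) (dist x y), ∀ s ∈ Icc (0 : ℝ) (dist x y), dist (c r) (c s) = |r - s|

/-- A geodesic triangle: three vertices and, for each `i` modulo 3, a geodesic side that joins
vertex `i` to vertex `i + 1`. -/
structure GeodesicTriangle (Y : Type*) [Dist Y] where
  vertex : Fin 3 → Y
  side : Fin 3 → ℝ → Y
  isGeodesic : ∀ i, IsGeodesic (side i) (vertex i) (vertex (i + 1))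

/-- The length of side `i` of a geodesic triangle. -/
def GeodesicTriangle.len {Y : Type*} [Dist Y] (Δ : GeodesicTriangle Y) (i : Fin 3) : ℝ :=
  dist (Δ.vertex i) (Δ.vertex (i + 1))

/-- The perimeter of a geodesic triangle. -/
def GeodesicTriangle.perimeter {Y : Type*} [Dist Y] (Δ : GeodesicTriangle Y) : ℝ :=
  ∑ i, Δ.len i

/-- For `κ > 0`, the model surface `M_κ²`: the unit sphere in `ℝ³`, with the spherical (angular)
distance multiplied by `1 / √κ`. -/
def ModelSphere (_κ : ℝ) : Type :=
  {p : EuclideanSpace ℝ (Fin 3) // ‖p‖ = 1}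

noncomputable instance (κ : ℝ) : Dist (ModelSphere κ) where
  dist p q := InnerProductGeometry.angle p.1 q.1 / √κ

/-- For `κ > 0`, the diameter `D_κ = π / √κ` of the model surface. -/
noncomputable def modelDiam (κ : ℝ) : ℝ := Real.pi / √κ

/-- `Δ'` is a comparison triangle for `Δ` in the model surface: corresponding sides have the same
length. -/
def IsComparisonTriangle {X : Type*} [Dist X] {κ : ℝ} (Δ : GeodesicTriangle X)
    (Δ' : GeodesicTriangle (ModelSphere κ)) : Prop :=
  ∀ i, Δ'.len i = Δ.len i

/-- `X` is a CAT(κ) space, for `κ > 0`: it is `D_κ`-geodesic, and in every geodesic triangle of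
perimeter less than `2 D_κ` the distance of any two points of the triangle is at most the distance
of their comparison points. The comparison point of the point at distance `r` from vertex `i` on
side `i` is the point at distance `r` from vertex `i` on side `i` of the comparison triangle. -/
structure IsCAT (κ : ℝ) (X : Type*) [MetricSpace X] : Prop where
  exists_geodesic : ∀ x y : X, dist x y < modelDiam κ → ∃ c : ℝ → X, IsGeodesic c x y
  cat_inequality : ∀ Δ : GeodesicTriangle X, Δ.perimeter < 2 * modelDiam κ →
    ∀ Δ' : GeodesicTriangle (ModelSphere κ), IsComparisonTriangle Δ Δ' →
      ∀ i j : Fin 3, ∀ r ∈ Icc (0 : ℝ) (Δ.len i), ∀ s ∈ Icc (0 : ℝ) (Δ.len j),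
        dist (Δ.side i r) (Δ.side j s) ≤ dist (Δ'.side i r) (Δ'.side j s)

/-- A subset of a metric space is convex if it contains every geodesic segment that joins two of
its points. -/
def IsGeodesicallyConvex {X : Type*} [MetricSpace X] (K : Set X) : Prop :=
  ∀ x ∈ K, ∀ y ∈ K, ∀ c : ℝ → X, IsGeodesic c x y → ∀ r ∈ Icc (0 : ℝ) (dist x y), c r ∈ K

/-- `T`, a map from `Y` to the nonempty closed bounded subsets of `Y`, is a generalized multivalued
hybrid mapping of type II with coefficient functions `a₁, a₂, a₃, k₁, k₂`. -/
structure IsGenHybridTypeII {Y : Type*} [MetricSpace Y] (T : Y → Set Y)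
    (a₁ a₂ a₃ k₁ k₂ : Y → ℝ) : Prop where
  nonempty : ∀ x, (T x).Nonempty
  isClosed : ∀ x, IsClosed (T x)
  isBounded : ∀ x, Bornology.IsBounded (T x)
  a₁_mem : ∀ x, a₁ x ∈ Icc (0 : ℝ) 1
  a₂_mem : ∀ x, a₂ x ∈ Icc (0 : ℝ) 1
  a₃_mem : ∀ x, a₃ x ∈ Icc (0 : ℝ) 1
  k₁_mem : ∀ x, k₁ x ∈ Icc (0 : ℝ) 1
  k₂_mem : ∀ x, k₂ x ∈ Icc (0 : ℝ) 1
  sum_lt : ∀ x, a₁ x + a₂ x + a₃ x < 1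
  k₁_lt : ∀ x, 2 * k₁ x < 1 - a₂ x
  k₂_lt : ∀ x, 2 * k₂ x < 1 - a₃ x
  hybrid : ∀ x y,
    Metric.hausdorffDist (T x) (T y) ^ 2 ≤
      a₁ x * dist x y ^ 2 + a₂ x * Metric.infDist y (T x) ^ 2 + a₃ x * Metric.infDist x (T y) ^ 2
        + k₁ x * Metric.infDist x (T x) ^ 2 + k₂ x * Metric.infDist y (T y) ^ 2

/-- The set `F(T)` of fixed points of a multivalued mapping. -/
def fixedPoints {Y : Type*} (T : Y → Set Y) : Set Y := {x | x ∈ T x}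

/-- The sequence `x` is an orbit of nearest points of `T`: `x (n + 1)` is a point of `T (x n)`
whose distance to `x n` is the distance of `x n` to the set `T (x n)`. -/
def IsNearestOrbit {Y : Type*} [MetricSpace Y] (T : Y → Set Y) (x : ℕ → Y) : Prop :=
  ∀ n, x (n + 1) ∈ T (x n) ∧ dist (x (n + 1)) (x n) = Metric.infDist (x n) (T (x n))

end CATHybrid

namespace CATHybrid

section Metric

variable {Y : Type*} [MetricSpace Y] {T : Y → Set Y} {a₁ a₂ a₃ k₁ k₂ : Y → ℝ}

/-! Compactness of the values provides nearest-point orbits. Along such an orbit `x (n + 1) ∈ T (x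
n)`, so one cross term of the hybrid inequality vanishes; taking the two points in the right order,
the hypothesis `a₂ = 0` or `a₃ = 0` removes the other. What remains bounds the new squared step by
the old one and a fraction of itself, and the supremum condition makes the resulting ratio uniformly
less than 1 (`dist_sq_succ_le`). Hence the orbit is Cauchy. Passing to the limit in the hybrid
inequality at `z` and `x n` shows that the limit `z` lies in `T z` (`mem_of_tendsto`). -/

theorem exists_isNearestOrbit (hT : ∀ x, IsCompact (T x)) (hne : ∀ x, (T x).Nonempty) (x₀ : Y) :
    ∃ x : ℕ → Y, x 0 = x₀ ∧ IsNearestOrbit T x := by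
  choose f hfT hf using fun x => (hT x).exists_infDist_eq_dist (hne x) x
  refine ⟨fun n => f^[n] x₀, rfl, fun n => ?_⟩
  simp only [Function.iterate_succ_apply']
  exact ⟨hfT _, by rw [dist_comm, hf]⟩

theorem IsGenHybridTypeII.hausdorffEDist_ne_top (hT : IsGenHybridTypeII T a₁ a₂ a₃ k₁ k₂)
    (x y : Y) : Metric.hausdorffEDist (T x) (T y) ≠ ⊤ :=
  Metric.hausdorffEDist_ne_top_of_nonempty_of_bounded (hT.nonempty x) (hT.nonempty y)
    (hT.isBounded x) (hT.isBounded y)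

/-- If `a₂ = 0` or `a₃ = 0`, then the squares of the distances of consecutive points of an orbit
of nearest points decrease geometrically. In the first case the hybrid inequality is applied to
`x (n + 1)` and `x n`, in the second one to `x n` and `x (n + 1)`. -/
theorem IsGenHybridTypeII.dist_sq_succ_le (hT : IsGenHybridTypeII T a₁ a₂ a₃ k₁ k₂)
    (hzero : (∀ x, a₂ x = 0) ∨ ∀ x, a₃ x = 0) {q : ℝ} (hq : q < 1)
    (hle : ∀ x, a₁ x + k₁ x ≤ q * (1 - k₂ x)) {x : ℕ → Y} (hx : IsNearestOrbit T x) (n : ℕ) :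
    dist (x (n + 2)) (x (n + 1)) ^ 2 ≤ (1 + q) / 2 * dist (x (n + 1)) (x n) ^ 2 := by
  -- Since `k₂ < 1/2`, the sum is at most `q + (1 - q) * k₂ ≤ (1 + q) / 2`.
  have hsum : ∀ y, a₁ y + k₁ y + k₂ y ≤ (1 + q) / 2 := fun y => by
    have h₁ := hle y
    have h₂ := hT.k₂_lt y
    have h₃ := (hT.a₃_mem y).1
    nlinarith
  -- Here `d` and `e` stand for the old and new squared steps; the term `u * e` is absorbed on the
  -- left.
  have key : ∀ {s t u d e : ℝ}, 0 ≤ u → u < 1 / 2 → s + t + u ≤ (1 + q) / 2 →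
      e ≤ s * d + t * d + u * e → 0 ≤ d → e ≤ (1 + q) / 2 * d := by
    intro s t u d e hu hu' hstu he hd
    have h : (1 - u) * e ≤ (1 - u) * ((1 + q) / 2 * d) := by
      have h₁ : 0 ≤ u * ((1 - q) / 2) := mul_nonneg hu (by linarith)
      have h₂ : (s + t) * d ≤ (1 - u) * ((1 + q) / 2) * d :=
        mul_le_mul_of_nonneg_right (by linarith) hd
      linarith
    exact le_of_mul_le_mul_left h (by linarith)
  obtain ⟨hmem, hdist⟩ := hx n
  have hdist' := (hx (n + 1)).2
  have hin : Metric.infDist (x (n + 1)) (T (x n)) = 0 := Metric.infDist_zero_of_mem hmem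
  rcases hzero with h0 | h0
  · have hH : dist (x (n + 2)) (x (n + 1)) ≤ Metric.hausdorffDist (T (x (n + 1))) (T (x n)) := by
      rw [hdist', Metric.hausdorffDist_comm]
      exact Metric.infDist_le_hausdorffDist_of_mem hmem (hT.hausdorffEDist_ne_top _ _)
    have hy := hT.hybrid (x (n + 1)) (x n)
    rw [h0, hin, ← hdist, ← hdist'] at hy
    have hsq := pow_le_pow_left₀ dist_nonneg hH 2
    have := hT.k₁_lt (x (n + 1))
    rw [h0] at this
    refine key (s := a₁ (x (n + 1))) (t := k₂ (x (n + 1))) (hT.k₁_mem (x (n + 1))).1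
      (by linarith) (by linarith [hsum (x (n + 1))]) (hsq.trans ?_) (sq_nonneg _)
    linarith
  · have hH : dist (x (n + 2)) (x (n + 1)) ≤ Metric.hausdorffDist (T (x n)) (T (x (n + 1))) := by
      rw [hdist']
      exact Metric.infDist_le_hausdorffDist_of_mem hmem (hT.hausdorffEDist_ne_top _ _)
    have hy := hT.hybrid (x n) (x (n + 1))
    rw [h0, hin, ← hdist, ← hdist', dist_comm (x n)] at hy
    have hsq := pow_le_pow_left₀ dist_nonneg hH 2
    have := hT.k₂_lt (x n)
    rw [h0] at this
    refine key (s := a₁ (x n)) (t := k₁ (x n)) (hT.k₂_mem (x n)).1 (by linarith) (hsum (x n))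
      (hsq.trans ?_) (sq_nonneg _)
    linarith

/-- Taking square roots, the steps themselves shrink by the factor `√q < 1`. -/
theorem cauchySeq_of_dist_sq_succ_le {x : ℕ → Y} {q : ℝ} (hq0 : 0 ≤ q) (hq : q < 1)
    (h : ∀ n, dist (x (n + 2)) (x (n + 1)) ^ 2 ≤ q * dist (x (n + 1)) (x n) ^ 2) :
    CauchySeq x := by
  refine cauchySeq_of_le_geometric (√q) (dist (x 1) (x 0))
    ((Real.sqrt_lt' one_pos).2 (by simpa using hq)) fun n => ?_
  rw [dist_comm]
  induction n with
  | zero => simp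
  | succ n ih =>
    calc dist (x (n + 2)) (x (n + 1)) ≤ √q * dist (x (n + 1)) (x n) := by
          refine le_of_sq_le_sq ?_ (by positivity)
          rw [mul_pow, Real.sq_sqrt hq0]
          exact h n
      _ ≤ √q * (dist (x 1) (x 0) * √q ^ n) := by gcongr
      _ = dist (x 1) (x 0) * √q ^ (n + 1) := by ring

/-- The limit of a convergent orbit of nearest points is a fixed point. -/
theorem IsGenHybridTypeII.mem_of_tendsto (hT : IsGenHybridTypeII T a₁ a₂ a₃ k₁ k₂)
    {x : ℕ → Y} (hx : IsNearestOrbit T x) {z : Y} (hz : Tendsto x atTop (𝓝 z)) : z ∈ T z := by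
  have hz' : Tendsto (fun n => x (n + 1)) atTop (𝓝 z) := hz.comp (tendsto_add_atTop_nat 1)
  have hd : Tendsto (fun n => dist z (x n)) atTop (𝓝 0) := by
    simpa using (tendsto_const_nhds (x := z)).dist hz
  have hd' : Tendsto (fun n => dist z (x (n + 1))) atTop (𝓝 0) := by
    simpa using (tendsto_const_nhds (x := z)).dist hz'
  have hs : Tendsto (fun n => dist (x (n + 1)) (x n)) atTop (𝓝 0) := by
    simpa using hz'.dist hz
  have hi : Tendsto (fun n => Metric.infDist (x n) (T z)) atTop (𝓝 (Metric.infDist z (T z))) :=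
    ((Metric.continuous_infDist_pt _).tendsto z).comp hz
  have hi' : Tendsto (fun n => Metric.infDist (x (n + 1)) (T z)) atTop
      (𝓝 (Metric.infDist z (T z))) :=
    ((Metric.continuous_infDist_pt _).tendsto z).comp hz'
  have hbound : ∀ n, Metric.infDist (x (n + 1)) (T z) ^ 2 ≤
      a₁ z * dist z (x n) ^ 2 + a₂ z * Metric.infDist (x n) (T z) ^ 2
        + a₃ z * dist z (x (n + 1)) ^ 2 + k₁ z * Metric.infDist z (T z) ^ 2
        + k₂ z * dist (x (n + 1)) (x n) ^ 2 := fun n => by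
    have hH : Metric.infDist (x (n + 1)) (T z) ≤ Metric.hausdorffDist (T z) (T (x n)) := by
      rw [Metric.hausdorffDist_comm]
      exact Metric.infDist_le_hausdorffDist_of_mem (hx n).1 (hT.hausdorffEDist_ne_top _ _)
    refine (pow_le_pow_left₀ Metric.infDist_nonneg hH 2).trans ((hT.hybrid z (x n)).trans ?_)
    rw [(hx n).2]
    have := (hT.a₃_mem z).1
    have := Metric.infDist_le_dist_of_mem (x := z) (hx n).1
    have := Metric.infDist_nonneg (x := z) (s := T (x n))
    gcongr
  -- With `D = infDist z (T z)`, the limit reads `D² ≤ (a₂ z + k₁ z) * D²`, and `a₂ z + k₁ z < 1`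
  -- forces `D = 0`.
  have hlim := le_of_tendsto_of_tendsto' (hi'.pow 2)
    ((((((hd.pow 2).const_mul (a₁ z)).add ((hi.pow 2).const_mul (a₂ z))).add
      ((hd'.pow 2).const_mul (a₃ z))).add_const (k₁ z * Metric.infDist z (T z) ^ 2)).add
      ((hs.pow 2).const_mul (k₂ z))) hbound
  have hcoef : 0 < 1 - a₂ z - k₁ z := by
    linarith [hT.k₁_lt z, hT.sum_lt z, (hT.a₁_mem z).1, (hT.a₃_mem z).1]
  have hsq : Metric.infDist z (T z) ^ 2 = 0 := by
    nlinarith [sq_nonneg (Metric.infDist z (T z))]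
  exact ((hT.isClosed z).mem_iff_infDist_zero (hT.nonempty z)).2
    (pow_eq_zero_iff two_ne_zero |>.1 hsq)

theorem IsGenHybridTypeII.le_iSup_mul (hT : IsGenHybridTypeII T a₁ a₂ a₃ k₁ k₂) (x : Y) :
    0 ≤ (⨆ x, (a₁ x + k₁ x) / (1 - k₂ x)) ∧
      a₁ x + k₁ x ≤ (⨆ x, (a₁ x + k₁ x) / (1 - k₂ x)) * (1 - k₂ x) := by
  have hk : ∀ y, 1 / 2 < 1 - k₂ y := fun y => by linarith [hT.k₂_lt y, (hT.a₃_mem y).1]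
  -- A real supremum bounds its family only if the family is bounded above; here numerators are at
  -- most 2 and denominators exceed 1/2.
  have hbdd : BddAbove (range fun y => (a₁ y + k₁ y) / (1 - k₂ y)) := by
    refine ⟨4, ?_⟩
    rintro _ ⟨y, rfl⟩
    change (a₁ y + k₁ y) / (1 - k₂ y) ≤ 4
    rw [div_le_iff₀ (by linarith [hk y])]
    linarith [hk y, (hT.a₁_mem y).2, (hT.k₁_mem y).2]
  have hle := le_ciSup hbdd x
  refine ⟨le_trans (div_nonneg ?_ (by linarith [hk x])) hle,
    (div_le_iff₀ (by linarith [hk x])).1 hle⟩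
  exact add_nonneg (hT.a₁_mem x).1 (hT.k₁_mem x).1

end Metric

end CATHybrid

theorem mainTheorem3 {X : Type*} [MetricSpace X] [CompleteSpace X]
    (κ ε R : ℝ) (hκ : 0 < κ) (hε : ε ∈ Ioo 0 (Real.pi / 2))
    (hR : R = (Real.pi - 2 * ε) * Real.tan ε)
    (hX : CATHybrid.IsCAT κ X)
    (hbdd : Bornology.IsBounded (univ : Set X))
    (hdiam : Metric.diam (univ : Set X) ≤ (Real.pi - ε) / (2 * √κ))
    (K : Set X) (hKne : K.Nonempty) (hKclosed : IsClosed K)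
    (hKconvex : CATHybrid.IsGeodesicallyConvex K)
    (T : K → TopologicalSpace.NonemptyCompacts K)
    (a₁ a₂ a₃ k₁ k₂ : K → ℝ)
    (hT : CATHybrid.IsGenHybridTypeII (fun x => (T x : Set K)) a₁ a₂ a₃ k₁ k₂)
    (hcases :
      (∀ x, a₂ x = 0 ∧ 2 * k₂ x / (1 - a₃ x) < R / 2) ∨
      (∀ x, a₃ x = 0 ∧ 2 * k₁ x / (1 - a₂ x) < R / 2))
    (hsup : (⨆ x : K, (a₁ x + k₁ x) / (1 - k₂ x)) < 1) :
    (CATHybrid.fixedPoints (fun x => (T x : Set K))).Nonempty ∧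
    (∀ x₀ : K, ∃ x : ℕ → K, x 0 = x₀ ∧
      CATHybrid.IsNearestOrbit (fun x => (T x : Set K)) x) ∧
    (∀ x : ℕ → K, CATHybrid.IsNearestOrbit (fun x => (T x : Set K)) x →
      CauchySeq x ∧
      ∃ z ∈ CATHybrid.fixedPoints (fun x => (T x : Set K)), Tendsto x atTop (𝓝 z)) := by
  have hzero : (∀ x, a₂ x = 0) ∨ ∀ x, a₃ x = 0 :=
    hcases.imp (fun h x => (h x).1) fun h x => (h x).1
  have : CompleteSpace K := hKclosed.completeSpace_coe
  have hex := CATHybrid.exists_isNearestOrbit (fun x => (T x).isCompact) hT.nonempty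
  have hconv : ∀ x : ℕ → K, CATHybrid.IsNearestOrbit (fun x => (T x : Set K)) x →
      CauchySeq x ∧
      ∃ z ∈ CATHybrid.fixedPoints (fun x => (T x : Set K)), Tendsto x atTop (𝓝 z) := by
    intro x hx
    have hC : CauchySeq x :=
      CATHybrid.cauchySeq_of_dist_sq_succ_le (by linarith [(hT.le_iSup_mul (x 0)).1])
        (by linarith) (hT.dist_sq_succ_le hzero hsup (fun y => (hT.le_iSup_mul y).2) hx)
    obtain ⟨z, hz⟩ := cauchySeq_tendsto_of_complete hC
    exact ⟨hC, z, hT.mem_of_tendsto hx hz, hz⟩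
  refine ⟨?_, hex, hconv⟩
  obtain ⟨x₀, hx₀⟩ := hKne
  obtain ⟨x, -, hx⟩ := hex ⟨x₀, hx₀⟩
  obtain ⟨-, z, hz, -⟩ := hconv x hx
  exact ⟨z, hz⟩
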